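/- **Setting.** Types are given by $T ::= A \mid T_1\Rightarrow T_2$, where $A$ is one base type. Let $a$ and $f$ be two fixed constants and let $x$ range over a countably infinite set of variables; terms are taken up to renaming of $\lambda$-bound variables. - Standard terms: $t ::= x \mid \lambda x{:}T.\,t \mid t\ t' \mid a \mid f$. - Mixed terms: $m ::= x \mid \lambda x{:}T.\,m \mid m\ m' \mid a \mid f \mid A \mid T\Rightarrow m$; in particular every standard term and every type is a mixed term. - Standard values: $v ::= \lambda x{:}T.\,t \mid a \mid f$ with $t$ a standard term. Mixed values: $u ::= \lambda x{:}T.\,m \mid T\Rightarrow m \mid A \mid a \mid f$. - Call-by-value evaluation contexts: $E_c ::= * \mid (E_c\ m) \mid (u\ E_c)$. Unrestricted contexts: $E_a ::= * \mid (E_a\ m) \mid (m\ E_a) \mid \lambda x{:}T.\,E_a \mid T\Rightarrow E_a$. Write $[m'/x]m$ for capture-avoiding substitution and $E[m]$ for grafting $m$ at the hole $*$ of $E$. Concrete call-by-value reduction $\to_c$ is given by $$E_c[f\ a]\to_c E_c[a],\qquad E_c[(\lambda x{:}T.\,m)\ u]\to_c E_c[[u/x]m]\quad(u\text{ a mixed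 value}),$$ and abstract reduction $\to_a$ by $$E_a[(T\Rightarrow m)\ T]\to_a E_a[m],\quad E_a[\lambda x{:}T.\,m]\to_a E_a[T\Rightarrow [T/x]m],\quad E_a[f]\to_a E_a[A\Rightarrow A],\quad E_a[a]\to_a E_a[A].$$ Let $\to_{ca}$ be the union $\to_c\cup\to_a$, let $\to^*$ denote the reflexive transitive closure of $\to$, and write $m\not\to_c$ if there is no $m'$ with $m\to_c m'$. **Theorem.** Let $t$ be a closed standard term and $T$ a type such that $t\to_{ca}^* T$. 1. (Generalized Type Safety) If $t\to_c^* t'$ and $t'\not\to_c$, then $t'$ is a standard value. 2. (Generalized Progress) If $t\not\to_c$, then $t$ is a standard value. -/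

import Mathlib

namespace STLC

/-- Simple types `T ::= A | T₁ ⇒ T₂` over the single base type `A`. -/
inductive Ty : Type
  | base : Ty
  | arrow : Ty → Ty → Ty

/-- Mixed terms `m ::= x | λ x:T. m | m m' | a | f | A | T ⇒ m`, up to renaming of bound variables:
variables are de Bruijn indices, and `lam` is the only binder. An index that is not less than the
number of enclosing `lam`s stands for a free variable. -/
inductive Mixed : Type
  | var : ℕ → Mixed
  | lam : Ty → Mixed → Mixed
  | app : Mixed → Mixed → Mixed
  | cA : Mixed
  | cF : Mixed
  | base : Mixed
  | arrow : Ty → Mixed → Mixed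

/-- Every type is a mixed term. -/
def Ty.toMixed : Ty → Mixed
  | .base => .base
  | .arrow T₁ T₂ => .arrow T₁ T₂.toMixed

/-- Standard terms `t ::= x | λ x:T. t | t t' | a | f`, as mixed terms. -/
inductive IsStandard : Mixed → Prop
  | var (n : ℕ) : IsStandard (.var n)
  | lam (T : Ty) {t : Mixed} : IsStandard t → IsStandard (.lam T t)
  | app {t s : Mixed} : IsStandard t → IsStandard s → IsStandard (.app t s)
  | cA : IsStandard .cA
  | cF : IsStandard .cF

/-- Standard values `v ::= λ x:T. t | a | f`, with `t` a standard term. -/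
inductive IsStandardValue : Mixed → Prop
  | lam (T : Ty) {t : Mixed} : IsStandard t → IsStandardValue (.lam T t)
  | cA : IsStandardValue .cA
  | cF : IsStandardValue .cF

/-- Mixed values `u ::= λ x:T. m | T ⇒ m | A | a | f`. -/
inductive IsMixedValue : Mixed → Prop
  | lam (T : Ty) (m : Mixed) : IsMixedValue (.lam T m)
  | arrow (T : Ty) (m : Mixed) : IsMixedValue (.arrow T m)
  | base : IsMixedValue .base
  | cA : IsMixedValue .cA
  | cF : IsMixedValue .cF

/-- `FreeIn i m`: the `i`-th free variable of the ambient scope occurs in `m`. -/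
def FreeIn : ℕ → Mixed → Prop
  | i, .var n => n = i
  | i, .lam _ m => FreeIn (i + 1) m
  | i, .app m₁ m₂ => FreeIn i m₁ ∨ FreeIn i m₂
  | _, .cA => False
  | _, .cF => False
  | _, .base => False
  | i, .arrow _ m => FreeIn i m

/-- A term is closed if it has no free variables. -/
def Closed (m : Mixed) : Prop := ∀ i, ¬ FreeIn i m

/-- Lift a renaming under one binder. -/
def upRen (ξ : ℕ → ℕ) : ℕ → ℕ
  | 0 => 0
  | n + 1 => ξ n + 1

/-- Renaming of free variables. -/
def Mixed.rename : (ℕ → ℕ) → Mixed → Mixed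
  | ξ, .var n => .var (ξ n)
  | ξ, .lam T m => .lam T (m.rename (upRen ξ))
  | ξ, .app m₁ m₂ => .app (m₁.rename ξ) (m₂.rename ξ)
  | _, .cA => .cA
  | _, .cF => .cF
  | _, .base => .base
  | ξ, .arrow T m => .arrow T (m.rename ξ)

/-- Lift a substitution under one binder. -/
def upSub (σ : ℕ → Mixed) : ℕ → Mixed
  | 0 => .var 0
  | n + 1 => (σ n).rename Nat.succ

/-- Simultaneous capture-avoiding substitution. -/
def Mixed.subst : (ℕ → Mixed) → Mixed → Mixed
  | σ, .var n => σ n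
  | σ, .lam T m => .lam T (m.subst (upSub σ))
  | σ, .app m₁ m₂ => .app (m₁.subst σ) (m₂.subst σ)
  | _, .cA => .cA
  | _, .cF => .cF
  | _, .base => .base
  | σ, .arrow T m => .arrow T (m.subst σ)

/-- The substitution that replaces the variable `0` by `u` and lowers the other variables. -/
def instSub (u : Mixed) : ℕ → Mixed
  | 0 => u
  | n + 1 => .var n

/-- `m.inst u` is `[u/x]m`, where `m` is the body of an abstraction over `x`. -/
def Mixed.inst (m u : Mixed) : Mixed := m.subst (instSub u)

/-- Call-by-value evaluation contexts `E_c ::= * | (E_c m) | (u E_c)`, with `u` a mixed value. -/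
inductive CbvCtx : Type
  | hole : CbvCtx
  | appL : CbvCtx → Mixed → CbvCtx
  | appR : (u : Mixed) → IsMixedValue u → CbvCtx → CbvCtx

/-- Unrestricted evaluation contexts `E_a ::= * | (E_a m) | (m E_a) | λ x:T. E_a | T ⇒ E_a`. -/
inductive FullCtx : Type
  | hole : FullCtx
  | appL : FullCtx → Mixed → FullCtx
  | appR : Mixed → FullCtx → FullCtx
  | lam : Ty → FullCtx → FullCtx
  | arrow : Ty → FullCtx → FullCtx

/-- `E.fill m` is `E_c[m]`. -/
def CbvCtx.fill : CbvCtx → Mixed → Mixed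
  | .hole, m => m
  | .appL E m', m => .app (E.fill m) m'
  | .appR u _ E, m => .app u (E.fill m)

/-- `E.fill m` is `E_a[m]` (grafting: variables of `m` may be bound by `E`). -/
def FullCtx.fill : FullCtx → Mixed → Mixed
  | .hole, m => m
  | .appL E m', m => .app (E.fill m) m'
  | .appR m' E, m => .app m' (E.fill m)
  | .lam T E, m => .lam T (E.fill m)
  | .arrow T E, m => .arrow T (E.fill m)

/-- Concrete call-by-value reduction `→_c`. -/
inductive StepC : Mixed → Mixed → Prop
  | fbeta (E : CbvCtx) : StepC (E.fill (.app .cF .cA)) (E.fill .cA)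
  | beta (E : CbvCtx) (T : Ty) (m u : Mixed) : IsMixedValue u →
      StepC (E.fill (.app (.lam T m) u)) (E.fill (m.inst u))

/-- Abstract reduction `→_a`. -/
inductive StepA : Mixed → Mixed → Prop
  | beta (E : FullCtx) (T : Ty) (m : Mixed) :
      StepA (E.fill (.app (.arrow T m) T.toMixed)) (E.fill m)
  | lam (E : FullCtx) (T : Ty) (m : Mixed) :
      StepA (E.fill (.lam T m)) (E.fill (.arrow T (m.inst T.toMixed)))
  | cF (E : FullCtx) : StepA (E.fill .cF) (E.fill (.arrow .base .base))
  | cA (E : FullCtx) : StepA (E.fill .cA) (E.fill .base)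

/-- Combined reduction `→_ca`, the union of `→_c` and `→_a`. -/
def StepCA (m m' : Mixed) : Prop := StepC m m' ∨ StepA m m'

/-- `m` is normal for `→_c`. -/
def NormalC (m : Mixed) : Prop := ∀ m', ¬ StepC m m'

end STLC

/-!
Let a standard term `t` reach a mixed value. Every mixed term that is not a value splits uniquely
as `E[r]`, with `E` a call-by-value context and `r` a variable or an application of two values.
Abstract steps may occur anywhere, but each one acts either on `E` alone or on `r` alone. Hence it
suffices to follow the fate of `r` along the given reduction.

If `r` is a concrete redex with contractum `n`, then `E[n]` can follow every step of `E[r]`. An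
abstract step inside the argument of `r` is matched by steps in the copies made by substitution.
An abstracted redex `(T ⇒ [T/x]m) u` is consumed only after `u` has been abstracted to `T`, and then
`[u/x]m` reduces to `[T/x]m`. Thus concrete steps preserve reducibility to a value. If `r` is stuck,
it stays stuck under all steps, so a value is never reached. Since a `→_c`-normal standard term is
either a standard value or of the form `E[r]` with `r` stuck, both claims follow.
-/

namespace STLC

open Relation

section Substitution

variable (ξ : ℕ → ℕ) (σ τ : ℕ → Mixed) (m u : Mixed)

theorem upSub_var_comp : upSub (Mixed.var ∘ ξ) = Mixed.var ∘ upRen ξ := by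
  funext n; cases n <;> rfl

theorem upSub_var : upSub Mixed.var = Mixed.var := by
  funext n; cases n <;> rfl

theorem upSub_comp_upRen : upSub σ ∘ upRen ξ = upSub (σ ∘ ξ) := by
  funext n; cases n <;> rfl

theorem Mixed.rename_eq_subst : m.rename ξ = m.subst (Mixed.var ∘ ξ) := by
  induction m generalizing ξ <;> simp_all [Mixed.rename, Mixed.subst, upSub_var_comp]

theorem Mixed.subst_var : m.subst Mixed.var = m := by
  induction m <;> simp_all [Mixed.subst, upSub_var]

theorem Mixed.subst_rename : (m.rename ξ).subst σ = m.subst (σ ∘ ξ) := by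
  induction m generalizing ξ σ <;> simp_all [Mixed.rename, Mixed.subst, upSub_comp_upRen]

theorem Mixed.rename_succ_rename :
    (m.rename Nat.succ).rename (upRen ξ) = (m.rename ξ).rename Nat.succ := by
  rw [Mixed.rename_eq_subst (upRen ξ), Mixed.rename_eq_subst Nat.succ (m.rename ξ),
    Mixed.subst_rename, Mixed.subst_rename]
  rfl

theorem rename_comp_upSub :
    Mixed.rename (upRen ξ) ∘ upSub σ = upSub (Mixed.rename ξ ∘ σ) := by
  funext n
  cases n with
  | zero => rfl
  | succ n => exact Mixed.rename_succ_rename ξ (σ n)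

theorem Mixed.rename_subst : (m.subst σ).rename ξ = m.subst (Mixed.rename ξ ∘ σ) := by
  induction m generalizing ξ σ <;> simp_all [Mixed.rename, Mixed.subst, rename_comp_upSub]

theorem subst_comp_upSub :
    Mixed.subst (upSub τ) ∘ upSub σ = upSub (Mixed.subst τ ∘ σ) := by
  funext n
  cases n with
  | zero => rfl
  | succ n => exact (Mixed.subst_rename _ _ _).trans (Mixed.rename_subst _ _ _).symm

theorem Mixed.subst_subst : (m.subst σ).subst τ = m.subst (Mixed.subst τ ∘ σ) := by
  induction m generalizing σ τ <;> simp_all [Mixed.subst, subst_comp_upSub]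

theorem Mixed.subst_inst : (m.inst u).subst σ = (m.subst (upSub σ)).inst (u.subst σ) := by
  simp only [Mixed.inst, Mixed.subst_subst]
  congr 1
  funext n
  cases n with
  | zero => rfl
  | succ n => exact ((Mixed.subst_rename Nat.succ (instSub _) (σ n)).trans (Mixed.subst_var _)).symm

theorem Ty.subst_toMixed (T : Ty) : T.toMixed.subst σ = T.toMixed := by
  induction T <;> simp_all [Ty.toMixed, Mixed.subst]

end Substitution

section AbstractReduction

/-- Composition of unrestricted contexts: `E.comp E'` is `E[E']`. -/
def FullCtx.comp : FullCtx → FullCtx → FullCtx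
  | .hole, E' => E'
  | .appL E m, E' => .appL (E.comp E') m
  | .appR m E, E' => .appR m (E.comp E')
  | .lam T E, E' => .lam T (E.comp E')
  | .arrow T E, E' => .arrow T (E.comp E')

theorem FullCtx.fill_comp (E E' : FullCtx) (m : Mixed) :
    (E.comp E').fill m = E.fill (E'.fill m) := by
  induction E <;> simp_all [FullCtx.comp, FullCtx.fill]

theorem StepA.fill {m m' : Mixed} (h : StepA m m') (E : FullCtx) :
    StepA (E.fill m) (E.fill m') := by
  cases h <;> simp only [← FullCtx.fill_comp] <;> constructor

/-- Abstract reduction `→_a`, with the evaluation contexts unfolded into congruence rules; this form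
supports rule induction and inversion. -/
inductive AStep : Mixed → Mixed → Prop
  | beta (T : Ty) (m : Mixed) : AStep (.app (.arrow T m) T.toMixed) m
  | abs (T : Ty) (m : Mixed) : AStep (.lam T m) (.arrow T (m.inst T.toMixed))
  | cF : AStep .cF (.arrow .base .base)
  | cA : AStep .cA .base
  | appL {m m' : Mixed} (p : Mixed) : AStep m m' → AStep (.app m p) (.app m' p)
  | appR (p : Mixed) {m m' : Mixed} : AStep m m' → AStep (.app p m) (.app p m')
  | lam (T : Ty) {m m' : Mixed} : AStep m m' → AStep (.lam T m) (.lam T m')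
  | arrow (T : Ty) {m m' : Mixed} : AStep m m' → AStep (.arrow T m) (.arrow T m')

variable {m m' : Mixed}

theorem AStep.fill (h : AStep m m') (E : FullCtx) : AStep (E.fill m) (E.fill m') := by
  induction E with
  | hole => exact h
  | appL E p ih => exact .appL p ih
  | appR p E ih => exact .appR p ih
  | lam T E ih => exact .lam T ih
  | arrow T E ih => exact .arrow T ih

theorem stepA_iff_aStep : StepA m m' ↔ AStep m m' := by
  constructor
  · rintro (⟨E, T, m⟩ | ⟨E, T, m⟩ | E | E)
    · exact (AStep.beta T m).fill E
    · exact (AStep.abs T m).fill E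
    · exact AStep.cF.fill E
    · exact AStep.cA.fill E
  · intro h
    induction h with
    | beta T m => exact .beta .hole T m
    | abs T m => exact .lam .hole T m
    | cF => exact .cF .hole
    | cA => exact .cA .hole
    | appL p _ ih => exact ih.fill (.appL .hole p)
    | appR p _ ih => exact ih.fill (.appR p .hole)
    | lam T _ ih => exact ih.fill (.lam T .hole)
    | arrow T _ ih => exact ih.fill (.arrow T .hole)

theorem AStep.subst (h : AStep m m') (σ : ℕ → Mixed) :
    AStep (m.subst σ) (m'.subst σ) := by
  induction h generalizing σ with
  | beta T m =>
    simp only [Mixed.subst, Ty.subst_toMixed]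
    exact .beta T _
  | abs T m =>
    simp only [Mixed.subst, Mixed.subst_inst, Ty.subst_toMixed]
    exact .abs T _
  | cF => exact .cF
  | cA => exact .cA
  | appL p _ ih => exact .appL _ (ih σ)
  | appR p _ ih => exact .appR _ (ih σ)
  | lam T _ ih => exact .lam T (ih _)
  | arrow T _ ih => exact .arrow T (ih σ)

theorem reflTransGen_aStep_upSub {σ τ : ℕ → Mixed} (h : ∀ n, ReflTransGen AStep (σ n) (τ n))
    (n : ℕ) : ReflTransGen AStep (upSub σ n) (upSub τ n) := by
  cases n with
  | zero => exact .refl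
  | succ n =>
    simp only [upSub, Mixed.rename_eq_subst]
    exact (h n).lift _ fun _ _ hs => hs.subst _

theorem Mixed.reflTransGen_aStep_subst (m : Mixed) {σ τ : ℕ → Mixed}
    (h : ∀ n, ReflTransGen AStep (σ n) (τ n)) :
    ReflTransGen AStep (m.subst σ) (m.subst τ) := by
  induction m generalizing σ τ with
  | var n => exact h n
  | lam T m ih =>
    exact (ih (reflTransGen_aStep_upSub h)).lift (Mixed.lam T) fun _ _ => AStep.lam T
  | app m p ihm ihp =>
    exact ((ihm h).lift (Mixed.app · _) fun _ _ => AStep.appL _).trans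
      ((ihp h).lift (Mixed.app _ ·) fun _ _ => AStep.appR _)
  | cA | cF | base => exact .refl
  | arrow T m ih => exact (ih h).lift (Mixed.arrow T) fun _ _ => AStep.arrow T

theorem Mixed.reflTransGen_aStep_inst (m : Mixed) {u u' : Mixed} (h : ReflTransGen AStep u u') :
    ReflTransGen AStep (m.inst u) (m.inst u') := by
  refine m.reflTransGen_aStep_subst fun n => ?_
  cases n with
  | zero => exact h
  | succ n => exact .refl

theorem IsMixedValue.aStep {u u' : Mixed} (hu : IsMixedValue u) (h : AStep u u') :
    IsMixedValue u' := by
  cases hu <;> cases h <;> constructor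

theorem Ty.isMixedValue_toMixed (T : Ty) : IsMixedValue T.toMixed := by
  cases T <;> constructor

end AbstractReduction

section Decomposition

/-- The terms that can occupy the hole when a non-value is split into a call-by-value context and
the subterm to be evaluated next: variables and applications of a value to a value. Some of them
are redexes, the others block evaluation. -/
inductive IsPotentialRedex : Mixed → Prop
  | var (n : ℕ) : IsPotentialRedex (.var n)
  | app {u v : Mixed} : IsMixedValue u → IsMixedValue v → IsPotentialRedex (.app u v)

/-- Concrete reduction `→_c` in the empty context. -/
inductive HeadStep : Mixed → Mixed → Prop
  | delta : HeadStep (.app .cF .cA) .cA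
  | beta (T : Ty) (m : Mixed) {u : Mixed} : IsMixedValue u →
      HeadStep (.app (.lam T m) u) (m.inst u)

/-- Composition of call-by-value contexts: `E.comp E'` is `E[E']`. -/
def CbvCtx.comp : CbvCtx → CbvCtx → CbvCtx
  | .hole, E' => E'
  | .appL E m, E' => .appL (E.comp E') m
  | .appR u hu E, E' => .appR u hu (E.comp E')

theorem CbvCtx.fill_comp (E E' : CbvCtx) (m : Mixed) :
    (E.comp E').fill m = E.fill (E'.fill m) := by
  induction E <;> simp_all [CbvCtx.comp, CbvCtx.fill]

variable {m m' r n : Mixed}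

theorem stepC_iff_exists_headStep :
    StepC m m' ↔ ∃ (E : CbvCtx) (r n : Mixed), HeadStep r n ∧ E.fill r = m ∧ E.fill n = m' := by
  constructor
  · rintro (E | ⟨E, T, m, u, hu⟩)
    · exact ⟨E, _, _, .delta, rfl, rfl⟩
    · exact ⟨E, _, _, .beta T m hu, rfl, rfl⟩
  · rintro ⟨E, r, n, _ | ⟨T, m, hu⟩, rfl, rfl⟩
    · exact .fbeta E
    · exact .beta E T m _ hu

theorem StepC.fill (h : StepC m m') (E : CbvCtx) : StepC (E.fill m) (E.fill m') := by
  cases h with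
  | fbeta E' => simpa only [CbvCtx.fill_comp] using StepC.fbeta (E.comp E')
  | beta E' T m u hu => simpa only [CbvCtx.fill_comp] using StepC.beta (E.comp E') T m u hu

theorem AStep.fill_cbv (h : AStep m m') (E : CbvCtx) : AStep (E.fill m) (E.fill m') := by
  induction E with
  | hole => exact h
  | appL E p ih => exact .appL p ih
  | appR u _ E ih => exact .appR u ih

theorem HeadStep.isPotentialRedex (h : HeadStep r n) : IsPotentialRedex r := by
  cases h with
  | delta => exact .app .cF .cA
  | beta T m hu => exact .app (.lam T m) hu

theorem IsPotentialRedex.not_isMixedValue_fill (hr : IsPotentialRedex r) (E : CbvCtx) :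
    ¬ IsMixedValue (E.fill r) := by
  cases E with
  | hole => cases hr <;> nofun
  | appL | appR => nofun

theorem IsPotentialRedex.eq_hole_of_fill (hr : IsPotentialRedex r) {E : CbvCtx}
    (h : IsPotentialRedex (E.fill r)) : E = .hole := by
  cases E with
  | hole => rfl
  | appL E p =>
    cases h with
    | app hE _ => exact absurd hE (hr.not_isMixedValue_fill E)
  | appR u _ E =>
    cases h with
    | app _ hE => exact absurd hE (hr.not_isMixedValue_fill E)

theorem IsPotentialRedex.fill_inj {r' : Mixed} (hr : IsPotentialRedex r)
    (hr' : IsPotentialRedex r') {E E' : CbvCtx} (h : E.fill r = E'.fill r') :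
    E = E' ∧ r = r' := by
  induction E generalizing E' with
  | hole =>
    obtain rfl := hr'.eq_hole_of_fill (h ▸ hr : IsPotentialRedex (E'.fill r'))
    exact ⟨rfl, h⟩
  | appL E p ih =>
    cases E' with
    | hole => cases hr.eq_hole_of_fill (h.symm ▸ hr' : IsPotentialRedex ((E.appL p).fill r))
    | appL E' p' =>
      obtain ⟨hE, rfl⟩ := Mixed.app.inj h
      obtain ⟨rfl, rfl⟩ := ih hE
      exact ⟨rfl, rfl⟩
    | appR u hu E' =>
      obtain ⟨rfl, -⟩ := Mixed.app.inj h
      exact absurd hu (hr.not_isMixedValue_fill E)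
  | appR u hu E ih =>
    cases E' with
    | hole => cases hr.eq_hole_of_fill (h.symm ▸ hr' : IsPotentialRedex ((E.appR u hu).fill r))
    | appL E' p' =>
      obtain ⟨rfl, -⟩ := Mixed.app.inj h
      exact absurd hu (hr'.not_isMixedValue_fill E')
    | appR u' _ E' =>
      obtain ⟨rfl, hE⟩ := Mixed.app.inj h
      obtain ⟨rfl, rfl⟩ := ih hE
      exact ⟨rfl, rfl⟩

theorem IsPotentialRedex.exists_headStep_of_stepC_fill (hr : IsPotentialRedex r) {E : CbvCtx}
    (h : StepC (E.fill r) m') : ∃ n, HeadStep r n ∧ m' = E.fill n := by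
  obtain ⟨E', r', n, hn, hfill, rfl⟩ := stepC_iff_exists_headStep.1 h
  obtain ⟨rfl, rfl⟩ := hn.isPotentialRedex.fill_inj hr hfill
  exact ⟨n, hn, rfl⟩

theorem IsPotentialRedex.aStep_fill_cases (hr : IsPotentialRedex r) {E : CbvCtx}
    (h : AStep (E.fill r) m') :
    (∃ r', AStep r r' ∧ m' = E.fill r') ∨
      ∃ E' : CbvCtx, m' = E'.fill r ∧ ∀ n, AStep (E.fill n) (E'.fill n) := by
  induction E generalizing m' with
  | hole => exact .inl ⟨m', h, rfl⟩
  | appL E p ih =>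
    change AStep (.app (E.fill r) p) m' at h
    generalize hq : E.fill r = q at h
    cases h with
    | beta T m => exact absurd (hq ▸ .arrow T _) (hr.not_isMixedValue_fill E)
    | appL _ h =>
      rcases ih (hq ▸ h) with ⟨r', hr', rfl⟩ | ⟨E', rfl, hE'⟩
      · exact .inl ⟨r', hr', rfl⟩
      · exact .inr ⟨.appL E' p, rfl, fun n => .appL p (hE' n)⟩
    | appR _ h => exact .inr ⟨.appL E _, hq ▸ rfl, fun _ => .appR _ h⟩
  | appR u hu E ih =>
    change AStep (.app u (E.fill r)) m' at h
    generalize hq : E.fill r = q at h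
    cases h with
    | beta T m => exact absurd (hq ▸ T.isMixedValue_toMixed) (hr.not_isMixedValue_fill E)
    | appL _ h => exact .inr ⟨.appR _ (hu.aStep h) E, hq ▸ rfl, fun _ => .appL _ h⟩
    | appR _ h =>
      rcases ih (hq ▸ h) with ⟨r', hr', rfl⟩ | ⟨E', rfl, hE'⟩
      · exact .inl ⟨r', hr', rfl⟩
      · exact .inr ⟨.appR u hu E', rfl, fun n => .appR u (hE' n)⟩

end Decomposition

section Contraction

/-- An invariant relating the descendants `r` of a concrete redex under abstract steps to
descendants `n` of its contractum. A redex `(λ x:T. m) u` whose function part has been abstracted is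
consumed only once `u` has been reduced to `T`, so in that case `n` need only reduce to the abstract
contractum under this assumption. -/
inductive Contracts : Mixed → Mixed → Prop
  | headStep {r n : Mixed} : HeadStep r n → Contracts r n
  | deltaBase : Contracts (.app .cF .base) .cA
  | arrow {T : Ty} {m u n : Mixed} : IsMixedValue u →
      (ReflTransGen AStep u T.toMixed → ReflTransGen AStep n m) →
      Contracts (.app (.arrow T m) u) n

variable {r n m w : Mixed}

theorem Contracts.isPotentialRedex (h : Contracts r n) : IsPotentialRedex r := by
  cases h with
  | headStep h => exact h.isPotentialRedex
  | deltaBase => exact .app .cF .base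
  | arrow hu _ => exact .app (.arrow _ _) hu

theorem Contracts.eq_of_headStep {n' : Mixed} (h : Contracts r n) (hn' : HeadStep r n') :
    n' = n := by
  cases hn' with
  | delta | beta =>
    cases h with
    | headStep hn => cases hn; rfl

theorem HeadStep.aStep_contracts {r' : Mixed} (h : HeadStep r n) (hr : AStep r r') :
    ∃ n', ReflTransGen AStep n n' ∧ Contracts r' n' := by
  cases h with
  | delta =>
    cases hr with
    | appL _ hf =>
      cases hf
      exact ⟨.cA, .refl, .arrow .cA id⟩
    | appR _ ha =>
      cases ha
      exact ⟨.cA, .refl, .deltaBase⟩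
  | beta T m hu =>
    cases hr with
    | appL _ hf =>
      cases hf with
      | abs => exact ⟨_, .refl, .arrow hu fun huT => m.reflTransGen_aStep_inst huT⟩
      | lam _ hm => exact ⟨_, .single (hm.subst _), .headStep (.beta T _ hu)⟩
    | appR _ hu' =>
      exact ⟨_, m.reflTransGen_aStep_inst (.single hu'), .headStep (.beta T m (hu.aStep hu'))⟩

theorem Contracts.aStep {r' : Mixed} (h : Contracts r n) (hr : AStep r r') :
    (∃ n', ReflTransGen AStep n n' ∧ Contracts r' n') ∨ ReflTransGen AStep n r' := by
  cases h with
  | headStep h => exact .inl (h.aStep_contracts hr)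
  | deltaBase =>
    cases hr with
    | appL _ hf =>
      cases hf
      exact .inl ⟨.cA, .refl, .arrow .base fun _ => .single .cA⟩
    | appR _ ha => cases ha
  | arrow hu hn =>
    cases hr with
    | beta => exact .inr (hn .refl)
    | appL _ hf =>
      cases hf with
      | arrow _ hm => exact .inl ⟨n, .refl, .arrow hu fun huT => (hn huT).tail hm⟩
    | appR _ hu' => exact .inl ⟨n, .refl, .arrow (hu.aStep hu') fun huT => hn (.head hu' huT)⟩

theorem reflTransGen_stepCA_fill (h : ReflTransGen AStep m n) (E : CbvCtx) :
    ReflTransGen StepCA (E.fill m) (E.fill n) :=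
  h.lift E.fill fun _ _ hs => .inr (stepA_iff_aStep.2 (hs.fill_cbv E))

theorem Contracts.reaches_value {E : CbvCtx} (h : Contracts r n) (hw : IsMixedValue w)
    (hrw : ReflTransGen StepCA (E.fill r) w) : ReflTransGen StepCA (E.fill n) w := by
  generalize hm : E.fill r = m at hrw
  induction hrw using ReflTransGen.head_induction_on generalizing E r n with
  | refl => exact absurd (hm ▸ hw) (h.isPotentialRedex.not_isMixedValue_fill E)
  | head hs hr ih =>
    subst hm
    rcases hs with hc | ha
    · obtain ⟨n', hn', rfl⟩ := h.isPotentialRedex.exists_headStep_of_stepC_fill hc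
      rwa [← h.eq_of_headStep hn']
    · rcases h.isPotentialRedex.aStep_fill_cases (stepA_iff_aStep.1 ha) with
        ⟨r', hr', rfl⟩ | ⟨E', rfl, hE'⟩
      · rcases h.aStep hr' with ⟨n', hn, hc⟩ | hn
        · exact (reflTransGen_stepCA_fill hn E).trans (ih hc rfl)
        · exact (reflTransGen_stepCA_fill hn E).trans hr
      · exact .head (.inr (stepA_iff_aStep.2 (hE' n))) (ih h rfl)

theorem StepC.reaches_value {m' : Mixed} (h : StepC m m') (hw : IsMixedValue w)
    (hmw : ReflTransGen StepCA m w) : ReflTransGen StepCA m' w := by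
  obtain ⟨E, r, n, hn, rfl, rfl⟩ := stepC_iff_exists_headStep.1 h
  exact (Contracts.headStep hn).reaches_value hw hmw

end Contraction

section Stuck

/-- Mixed values other than the constant `a` and its abstraction `A`. -/
inductive IsFunctional : Mixed → Prop
  | lam (T : Ty) (m : Mixed) : IsFunctional (.lam T m)
  | arrow (T : Ty) (m : Mixed) : IsFunctional (.arrow T m)
  | cF : IsFunctional .cF

/-- Potential redexes that block evaluation for good: variables and ill-typed applications of a
constant, where the constant may have been abstracted to its type. -/
inductive Stuck : Mixed → Prop
  | var (n : ℕ) : Stuck (.var n)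
  | cA {u : Mixed} : IsMixedValue u → Stuck (.app .cA u)
  | base {u : Mixed} : IsMixedValue u → Stuck (.app .base u)
  | cF {u : Mixed} : IsFunctional u → Stuck (.app .cF u)
  | arrow {u : Mixed} : IsFunctional u → Stuck (.app (.arrow .base .base) u)

variable {r w : Mixed}

theorem IsFunctional.isMixedValue {u : Mixed} (h : IsFunctional u) : IsMixedValue u := by
  cases h <;> constructor

theorem IsFunctional.aStep {u u' : Mixed} (h : IsFunctional u) (hs : AStep u u') :
    IsFunctional u' := by
  cases h <;> cases hs <;> constructor

theorem Stuck.isPotentialRedex (h : Stuck r) : IsPotentialRedex r := by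
  cases h with
  | var n => exact .var n
  | cA hu => exact .app .cA hu
  | base hu => exact .app .base hu
  | cF hu => exact .app .cF hu.isMixedValue
  | arrow hu => exact .app (.arrow _ _) hu.isMixedValue

theorem Stuck.not_headStep {n : Mixed} (h : Stuck r) : ¬ HeadStep r n := by
  intro hn
  cases hn with
  | delta =>
    cases h with
    | cF ha => cases ha
  | beta => cases h

theorem Stuck.aStep {r' : Mixed} (h : Stuck r) (hr : AStep r r') : Stuck r' := by
  cases h with
  | var n => cases hr
  | cA hu =>
    cases hr with
    | appL _ hs => cases hs; exact .base hu
    | appR _ hs => exact .cA (hu.aStep hs)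
  | base hu =>
    cases hr with
    | appL _ hs => cases hs
    | appR _ hs => exact .base (hu.aStep hs)
  | cF hu =>
    cases hr with
    | appL _ hs => cases hs; exact .arrow hu
    | appR _ hs => exact .cF (hu.aStep hs)
  | arrow hu =>
    cases hr with
    | beta => cases hu
    | appL _ hs =>
      cases hs with
      | arrow _ hs => cases hs
    | appR _ hs => exact .arrow (hu.aStep hs)

theorem Stuck.not_reaches_value {E : CbvCtx} (h : Stuck r) (hw : IsMixedValue w) :
    ¬ ReflTransGen StepCA (E.fill r) w := by
  intro hrw
  generalize hm : E.fill r = m at hrw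
  induction hrw using ReflTransGen.head_induction_on generalizing E r with
  | refl => exact h.isPotentialRedex.not_isMixedValue_fill E (hm ▸ hw)
  | head hs _ ih =>
    subst hm
    rcases hs with hc | ha
    · obtain ⟨n, hn, -⟩ := h.isPotentialRedex.exists_headStep_of_stepC_fill hc
      exact h.not_headStep hn
    · rcases h.isPotentialRedex.aStep_fill_cases (stepA_iff_aStep.1 ha) with
        ⟨r', hr', rfl⟩ | ⟨E', rfl, -⟩
      · exact ih (h.aStep hr') rfl
      · exact ih h rfl

end Stuck

section StandardTerms

variable {t t' r n : Mixed}

theorem IsStandard.rename (ht : IsStandard t) (ξ : ℕ → ℕ) : IsStandard (t.rename ξ) := by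
  induction ht generalizing ξ with
  | var n => exact .var _
  | lam T _ ih => exact .lam T (ih _)
  | app _ _ iht ihs => exact .app (iht ξ) (ihs ξ)
  | cA => exact .cA
  | cF => exact .cF

theorem IsStandard.subst (ht : IsStandard t) {σ : ℕ → Mixed} (hσ : ∀ n, IsStandard (σ n)) :
    IsStandard (t.subst σ) := by
  induction ht generalizing σ with
  | var n => exact hσ n
  | lam T _ ih =>
    refine .lam T (ih fun n => ?_)
    cases n with
    | zero => exact .var 0
    | succ n => exact (hσ n).rename _
  | app _ _ iht ihs => exact .app (iht hσ) (ihs hσ)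
  | cA => exact .cA
  | cF => exact .cF

theorem IsStandard.inst {u : Mixed} (ht : IsStandard t) (hu : IsStandard u) :
    IsStandard (t.inst u) := by
  refine ht.subst fun n => ?_
  cases n with
  | zero => exact hu
  | succ n => exact .var n

theorem IsStandard.headStep (hr : IsStandard r) (h : HeadStep r n) : IsStandard n := by
  cases h with
  | delta => exact .cA
  | beta T m _ =>
    cases hr with
    | app hl hu =>
      cases hl with
      | lam _ hm => exact hm.inst hu

theorem IsStandard.fill_imp {E : CbvCtx} (h : IsStandard (E.fill r))
    (hrn : IsStandard r → IsStandard n) : IsStandard (E.fill n) := by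
  induction E with
  | hole => exact hrn h
  | appL E p ih =>
    cases h with
    | app hE hp => exact .app (ih hE) hp
  | appR u _ E ih =>
    cases h with
    | app hu hE => exact .app hu (ih hE)

theorem IsStandard.stepC (ht : IsStandard t) (h : StepC t t') : IsStandard t' := by
  obtain ⟨E, r, n, hn, rfl, rfl⟩ := stepC_iff_exists_headStep.1 h
  exact ht.fill_imp fun hr => hr.headStep hn

theorem IsStandardValue.isMixedValue {v : Mixed} (h : IsStandardValue v) : IsMixedValue v := by
  cases h <;> constructor

theorem IsStandardValue.exists_headStep_or_stuck_app {v v' : Mixed} (hv : IsStandardValue v)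
    (hv' : IsStandardValue v') : (∃ n, HeadStep (.app v v') n) ∨ Stuck (.app v v') := by
  cases hv with
  | lam T _ => exact .inl ⟨_, .beta T _ hv'.isMixedValue⟩
  | cA => exact .inr (.cA hv'.isMixedValue)
  | cF =>
    cases hv' with
    | lam T _ => exact .inr (.cF (.lam T _))
    | cA => exact .inl ⟨_, .delta⟩
    | cF => exact .inr (.cF .cF)

theorem NormalC.of_fill {m : Mixed} {E : CbvCtx} (h : NormalC (E.fill m)) : NormalC m :=
  fun _ hs => h _ (hs.fill E)

theorem IsStandard.isStandardValue_or_stuck (ht : IsStandard t) (hn : NormalC t) :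
    IsStandardValue t ∨ ∃ (E : CbvCtx) (r : Mixed), Stuck r ∧ E.fill r = t := by
  induction ht with
  | var n => exact .inr ⟨.hole, _, .var n, rfl⟩
  | lam T ht _ => exact .inl (.lam T ht)
  | cA => exact .inl .cA
  | cF => exact .inl .cF
  | @app t s _ _ iht ihs =>
    rcases iht (hn.of_fill (E := .appL .hole s)) with hv | ⟨E, r, hr, rfl⟩
    · rcases ihs (hn.of_fill (E := .appR t hv.isMixedValue .hole)) with hv' | ⟨E, r, hr, rfl⟩
      · rcases hv.exists_headStep_or_stuck_app hv' with ⟨n, hstep⟩ | hstuck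
        · exact absurd (stepC_iff_exists_headStep.2 ⟨.hole, _, _, hstep, rfl, rfl⟩) (hn n)
        · exact .inr ⟨.hole, _, hstuck, rfl⟩
      · exact .inr ⟨.appR t hv.isMixedValue E, r, hr, rfl⟩
    · exact .inr ⟨.appL E s, r, hr, rfl⟩

theorem IsStandard.isStandardValue_of_reaches_value {w : Mixed} (ht : IsStandard t)
    (hw : IsMixedValue w) (htw : ReflTransGen StepCA t w) (hn : NormalC t) :
    IsStandardValue t := by
  rcases ht.isStandardValue_or_stuck hn with hv | ⟨E, r, hr, rfl⟩
  · exact hv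
  · exact absurd htw (hr.not_reaches_value hw)

end StandardTerms

end STLC

open STLC in
theorem mainTheorem11_general {t t' w : Mixed} (ht : IsStandard t) (hw : IsMixedValue w)
    (htw : Relation.ReflTransGen StepCA t w) (htt' : Relation.ReflTransGen StepC t t')
    (hn : NormalC t') : IsStandardValue t' := by
  induction htt' using Relation.ReflTransGen.head_induction_on with
  | refl => exact ht.isStandardValue_of_reaches_value hw htw hn
  | head hstep _ ih => exact ih (ht.stepC hstep) (hstep.reaches_value hw htw)

theorem mainTheorem11 :
    -- Generalized Type Safety
    (∀ (t t' : STLC.Mixed) (T : STLC.Ty),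
      STLC.IsStandard t → STLC.Closed t →
      Relation.ReflTransGen STLC.StepCA t T.toMixed →
      Relation.ReflTransGen STLC.StepC t t' → STLC.NormalC t' →
      STLC.IsStandardValue t') ∧
    -- Generalized Progress
    (∀ (t : STLC.Mixed) (T : STLC.Ty),
      STLC.IsStandard t → STLC.Closed t →
      Relation.ReflTransGen STLC.StepCA t T.toMixed → STLC.NormalC t →
      STLC.IsStandardValue t) :=
  ⟨fun _ _ T ht _ htT htt' hn => mainTheorem11_general ht T.isMixedValue_toMixed htT htt' hn,
    fun _ T ht _ htT hn => mainTheorem11_general ht T.isMixedValue_toMixed htT .refl hn⟩
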